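/- Let $p>1$ and $q>0$ be integers. Let $$D^{p,q}=\{z=(z_1,\dots,z_{p+q})\in\mathbb{C}^{p+q} : -|z_1|^2-\cdots-|z_q|^2+|z_{q+1}|^2+\cdots+|z_{p+q}|^2>0\},$$ and let $\mathrm{Aut}(D^{p,q})$ be the group of all biholomorphic mappings of $D^{p,q}$ onto itself, equipped with the compact-open topology. Let $J=\mathrm{diag}[-E_q,E_p]$, where $E_k$ is the $k\times k$ identity matrix, and let $$GU(p,q)=\{A\in GL(p+q,\mathbb{C}) : A^*JA=\nu J \text{ for some real } \nu>0\},$$ with the topology induced from $GL(p+q,\mathbb{C})$. Then the natural action of $GU(p,q)$ on $D^{p,q}$ gives an isomorphism of topological groups $GU(p,q)\simeq \mathrm{Aut}(D^{p,q})$: for each $A\in GU(p,q)$ the linear map $z\mapsto Az$ restricts to an automorphism of $D^{p,q}$, every automorphism of $D^{p,q}$ is of this form for exactly one $A\in GU(p,q)$, and the resulting bijection is a group isomorphism and a homeomorphism. -/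

import Mathlib

open scoped Matrix

noncomputable section

/-- The space `ℂ^{p+q}`, with coordinates indexed by `Fin q ⊕ Fin p`: the first `q` coordinates
carry the sign `-1` in the Hermitian form below, the last `p` coordinates the sign `+1`. -/
abbrev CSpace (p q : ℕ) : Type := Fin q ⊕ Fin p → ℂ

/-- The domain `D^{p,q}` of all `z` with
`-|z_1|² - ⋯ - |z_q|² + |z_{q+1}|² + ⋯ + |z_{p+q}|² > 0`. -/
def domainD (p q : ℕ) : Set (CSpace p q) :=
  {z | 0 < -(∑ i : Fin q, ‖z (Sum.inl i)‖ ^ 2) + ∑ j : Fin p, ‖z (Sum.inr j)‖ ^ 2}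

/-- The matrix `J = diag[-E_q, E_p]`. -/
def signMatrix (p q : ℕ) : Matrix (Fin q ⊕ Fin p) (Fin q ⊕ Fin p) ℂ :=
  Matrix.fromBlocks (-1) 0 0 1

/-- The general indefinite unitary group
`GU(p,q) = {A ∈ GL(p+q, ℂ) : A* J A = ν J for some real ν > 0}`,
with the subspace topology of `GL(p+q, ℂ)`. -/
def generalIndefiniteUnitaryGroup (p q : ℕ) : Subgroup (GL (Fin q ⊕ Fin p) ℂ) where
  carrier := {A | ∃ ν : ℝ, 0 < ν ∧
    (A : Matrix (Fin q ⊕ Fin p) (Fin q ⊕ Fin p) ℂ)ᴴ * signMatrix p q *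
      (A : Matrix (Fin q ⊕ Fin p) (Fin q ⊕ Fin p) ℂ) = (ν : ℂ) • signMatrix p q}
  one_mem' := ⟨1, one_pos, by simp⟩
  mul_mem' := by
    rintro A B ⟨a, ha, hA⟩ ⟨b, hb, hB⟩
    refine ⟨a * b, mul_pos ha hb, ?_⟩
    calc ((A * B : GL (Fin q ⊕ Fin p) ℂ) : Matrix (Fin q ⊕ Fin p) (Fin q ⊕ Fin p) ℂ)ᴴ *
          signMatrix p q * ((A * B : GL (Fin q ⊕ Fin p) ℂ) : Matrix _ _ ℂ)
        = (B : Matrix (Fin q ⊕ Fin p) (Fin q ⊕ Fin p) ℂ)ᴴ *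
          ((A : Matrix (Fin q ⊕ Fin p) (Fin q ⊕ Fin p) ℂ)ᴴ * signMatrix p q * A.val) *
            B.val := by
          simp only [Units.val_mul, Matrix.conjTranspose_mul, Matrix.mul_assoc]
      _ = ((a * b : ℝ) : ℂ) • signMatrix p q := by
          rw [hA, Matrix.mul_smul, Matrix.smul_mul, hB, smul_smul, Complex.ofReal_mul]
  inv_mem' := by
    rintro A ⟨a, ha, hA⟩
    refine ⟨a⁻¹, inv_pos.mpr ha, ?_⟩
    have h1 : A.val * (A⁻¹).val = 1 := by simp
    have h2 : ((A⁻¹).val)ᴴ * (A.val)ᴴ = 1 := by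
      rw [← Matrix.conjTranspose_mul, h1, Matrix.conjTranspose_one]
    have h3 : (a : ℂ) ≠ 0 := by exact_mod_cast ha.ne'
    have h4 : signMatrix p q =
        (a : ℂ) • (((A⁻¹).val)ᴴ * signMatrix p q * (A⁻¹).val) := by
      calc signMatrix p q
          = (((A⁻¹).val)ᴴ * (A.val)ᴴ) * signMatrix p q * (A.val * (A⁻¹).val) := by
            rw [h1, h2, Matrix.one_mul, Matrix.mul_one]
        _ = ((A⁻¹).val)ᴴ * ((A.val)ᴴ * signMatrix p q * A.val) * (A⁻¹).val := by
            simp only [Matrix.mul_assoc]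
        _ = _ := by rw [hA, Matrix.mul_smul, Matrix.smul_mul]
    conv_rhs => rw [h4]
    rw [smul_smul, Complex.ofReal_inv, inv_mul_cancel₀ h3, one_smul]

/-- A map `f : Ω → Ω'` between subsets of complex normed spaces is holomorphic if it is the
restriction to `Ω` of a function that is complex differentiable on `Ω`
(used for open sets `Ω` and `Ω'`). -/
def IsHolomorphicMap {E F : Type*} [NormedAddCommGroup E] [NormedSpace ℂ E]
    [NormedAddCommGroup F] [NormedSpace ℂ F] {Ω : Set E} {Ω' : Set F} (f : Ω → Ω') : Prop :=
  ∃ g : E → F, DifferentiableOn ℂ g Ω ∧ ∀ z : Ω, g z = f z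

/-- The group `Aut(Ω)` of all biholomorphic mappings of the open set `Ω` onto itself, with
composition as multiplication. (Biholomorphic mappings are in particular homeomorphisms.) -/
def holomorphicAut {E : Type*} [NormedAddCommGroup E] [NormedSpace ℂ E] (Ω : Set E) :
    Subgroup (Ω ≃ₜ Ω) where
  carrier := {f | IsHolomorphicMap (f : Ω → Ω) ∧ IsHolomorphicMap (f.symm : Ω → Ω)}
  one_mem' := ⟨⟨id, differentiableOn_id, fun _ => rfl⟩, ⟨id, differentiableOn_id, fun _ => rfl⟩⟩
  mul_mem' := by
    rintro f g ⟨⟨F, hF, hFf⟩, ⟨F', hF', hFf'⟩⟩ ⟨⟨G, hG, hGg⟩, ⟨G', hG', hGg'⟩⟩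
    refine ⟨⟨F ∘ G, hF.comp hG ?_, ?_⟩, ⟨G' ∘ F', hG'.comp hF' ?_, ?_⟩⟩
    · intro z hz
      rw [hGg ⟨z, hz⟩]
      exact (g ⟨z, hz⟩).2
    · intro z
      change F (G z) = f (g z)
      rw [hGg, hFf]
    · intro z hz
      rw [hFf' ⟨z, hz⟩]
      exact (f.symm ⟨z, hz⟩).2
    · intro z
      change G' (F' z) = g.symm (f.symm z)
      rw [hFf', hGg']
  inv_mem' := fun h => ⟨h.2, h.1⟩

/-- The compact-open topology on `Aut(Ω)`. -/
instance holomorphicAut.instTopologicalSpace {E : Type*} [NormedAddCommGroup E]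
    [NormedSpace ℂ E] (Ω : Set E) : TopologicalSpace (holomorphicAut Ω) :=
  TopologicalSpace.induced (fun f => ((f : Ω ≃ₜ Ω) : C(Ω, Ω))) ContinuousMap.compactOpen

end

/-! Write `h` for the Hermitian form of `J`, so that the domain is `h z z > 0`. Since `p > 1`, there
are two positive coordinates. A Cauchy integral in one of them extends a holomorphic map to the
whole space, and the other serves to show that the extension agrees with the map on all of the
domain (`cauchyExtension_eq`). Differentiability of the extension is only recorded along entire
curves, because every later argument has one complex parameter.

An automorphism and its inverse thus extend to mutually inverse maps `F` and `G` of the whole space.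
By continuity and invertibility `F` preserves the null cone of `h`. Polarising, with the
antidiagonal `(t, conj t)` as set of uniqueness, upgrades this to preservation of orthogonality
(`hermForm_map_eq_zero`); here `q > 0` supplies vectors of both signs.

Orthogonality forces `F` to map each complex line through the origin into another such line. On a
line it is an entire function with an entire left inverse that fixes 0, hence homogeneous
(`map_smul_of_orthogonal`); growth at infinity along affine lines then gives additivity. A linear
map preserving orthogonality rescales `h`, and preserving the domain makes the factor positive.

The inverse bijection is continuous because each column of the matrix is a difference of two values
of the automorphism. -/

open Filter Topology Set Metric

/-! ### Entire functions of one variable and a uniqueness set in two variables -/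

/-- A circle integral depending holomorphically on a parameter is holomorphic in the parameter. -/
theorem differentiableAt_circleIntegral_param {E : Type*} [NormedAddCommGroup E]
    [NormedSpace ℂ E] [CompleteSpace E] {g : ℂ → ℂ → E} {c : ℂ} {R : ℝ} (hR : 0 ≤ R)
    {s₀ : ℂ} {r : ℝ} (hr : 0 < r)
    (hc : ContinuousOn (Function.uncurry g) (closedBall s₀ r ×ˢ sphere c R))
    (hd : ∀ ζ ∈ sphere c R, ∀ s ∈ closedBall s₀ r, DifferentiableAt ℂ (fun s => g s ζ) s) :
    DifferentiableAt ℂ (fun s => ∮ ζ in C(c, R), g s ζ) s₀ := by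
  obtain ⟨M, hM⟩ := ((isCompact_closedBall s₀ r).prod (isCompact_sphere c R)).exists_bound_of_continuousOn hc
  have hsl (s : ℂ) (hs : s ∈ closedBall s₀ r) :
      Continuous fun θ : ℝ => deriv (circleMap c R) θ • g s (circleMap c R θ) := by
    have h1 : Continuous fun θ : ℝ => g s (circleMap c R θ) :=
      hc.comp_continuous (f := fun θ : ℝ => (s, circleMap c R θ)) (by fun_prop)
        fun θ => ⟨hs, circleMap_mem_sphere c hR θ⟩
    have h2 : Continuous (deriv (circleMap c R)) := by
      simp only [funext (deriv_circleMap c R)]; fun_prop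
    exact h2.smul h1
  have hder (θ : ℝ) (s : ℂ) (hs : s ∈ ball s₀ (r / 2)) :
      HasDerivAt (fun s => deriv (circleMap c R) θ • g s (circleMap c R θ))
        (deriv (circleMap c R) θ • deriv (fun s => g s (circleMap c R θ)) s) s :=
    ((hd _ (circleMap_mem_sphere c hR θ) s
      (ball_subset_closedBall (ball_subset_ball (by linarith) hs))).hasDerivAt).const_smul _
  have hbd (θ : ℝ) (s : ℂ) (hs : s ∈ ball s₀ (r / 2)) :
      ‖deriv (circleMap c R) θ • deriv (fun s => g s (circleMap c R θ)) s‖ ≤ R * (M / (r / 2)) := by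
    have hsub : closedBall s (r / 2) ⊆ closedBall s₀ r := by
      apply closedBall_subset_closedBall'
      have := mem_ball.1 hs
      linarith
    have h1 : ‖deriv (fun s => g s (circleMap c R θ)) s‖ ≤ M / (r / 2) := by
      refine Complex.norm_deriv_le_of_forall_mem_sphere_norm_le (by linarith) ?_ fun z hz =>
        hM (z, circleMap c R θ) ⟨hsub (sphere_subset_closedBall hz), circleMap_mem_sphere c hR θ⟩
      refine DifferentiableOn.diffContOnCl fun z hz => ?_
      rw [closure_ball _ (by linarith)] at hz
      exact (hd _ (circleMap_mem_sphere c hR θ) z (hsub hz)).differentiableWithinAt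
    rw [norm_smul]
    refine mul_le_mul ?_ h1 (norm_nonneg _) hR
    simp [abs_of_nonneg hR]
  have hball : ball s₀ (r / 2) ∈ 𝓝 s₀ := ball_mem_nhds _ (by linarith)
  refine (intervalIntegral.hasDerivAt_integral_of_dominated_loc_of_deriv_le
    (F' := fun s θ => deriv (circleMap c R) θ • deriv (fun s => g s (circleMap c R θ)) s)
    (bound := fun _ => R * (M / (r / 2))) hball ?_ ?_ ?_ ?_ ?_ ?_).2.differentiableAt
  · filter_upwards [closedBall_mem_nhds s₀ hr] with s hs
    exact (hsl s hs).aestronglyMeasurable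
  · exact (hsl s₀ (mem_closedBall_self hr.le)).intervalIntegrable _ _
  -- Measurability in `θ` of the derivative at `s₀`: it is a pointwise limit of difference
  -- quotients, each continuous in `θ`.
  · obtain ⟨u, -, hu, hlim⟩ := exists_seq_strictAnti_tendsto' (show (0 : ℝ) < r from hr)
    have hu0 : Tendsto (fun n => (u n : ℂ)) atTop (𝓝[≠] 0) := by
      refine tendsto_nhdsWithin_iff.2 ⟨?_, Eventually.of_forall fun n => ?_⟩
      · exact_mod_cast (Complex.continuous_ofReal.tendsto 0).comp hlim
      · simpa using (hu n).1.ne'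
    refine aestronglyMeasurable_of_tendsto_ae atTop
      (f := fun n θ => (u n : ℂ)⁻¹ • (deriv (circleMap c R) θ • g (s₀ + u n) (circleMap c R θ) -
        deriv (circleMap c R) θ • g s₀ (circleMap c R θ))) (fun n => ?_)
      (MeasureTheory.ae_of_all _ fun θ => ?_)
    · refine (((hsl _ ?_).sub (hsl _ (mem_closedBall_self hr.le))).const_smul _).aestronglyMeasurable
      simpa [mem_closedBall, abs_of_pos (hu n).1] using (hu n).2.le
    · exact (hasDerivAt_iff_tendsto_slope_zero.1 (hder θ s₀ (mem_ball_self (by linarith)))).comp hu0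
  · exact MeasureTheory.ae_of_all _ fun θ _ s hs => hbd θ s hs
  · exact intervalIntegrable_const
  · exact MeasureTheory.ae_of_all _ fun θ _ s hs => hder θ s hs

theorem differentiable_dslope {E : Type*} [NormedAddCommGroup E] [NormedSpace ℂ E]
    [CompleteSpace E] {f : ℂ → E} (hf : Differentiable ℂ f) (a : ℂ) :
    Differentiable ℂ (dslope f a) :=
  differentiableOn_univ.1 ((Complex.differentiableOn_dslope univ_mem).2 hf.differentiableOn)

/-- An entire function whose difference quotients tend to `a` at infinity is affine with slope `a`. -/
theorem Differentiable.eq_add_smul_of_tendsto {E : Type*} [NormedAddCommGroup E]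
    [NormedSpace ℂ E] [CompleteSpace E] {f : ℂ → E} (hf : Differentiable ℂ f) {a : E}
    (h : Tendsto (fun z => z⁻¹ • (f z - f 0)) (cocompact ℂ) (𝓝 a)) (z : ℂ) :
    f z = f 0 + z • a := by
  have h1 : Tendsto (dslope f 0) (cocompact ℂ) (𝓝 a) := by
    refine h.congr' ?_
    have : ∀ᶠ z : ℂ in cocompact ℂ, z ≠ 0 := by
      filter_upwards [(isCompact_singleton (x := (0 : ℂ))).compl_mem_cocompact] with z hz using hz
    filter_upwards [this] with z hz
    rw [dslope_of_ne _ hz, slope_def_module, sub_zero]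
  have h2 := (differentiable_dslope hf 0).apply_eq_of_tendsto_cocompact z h1
  have h3 := sub_smul_dslope f 0 z
  rw [h2, sub_zero] at h3
  rw [h3]; abel

/-- An entire function fixing the origin with an entire left inverse is linear. -/
theorem eq_mul_of_entire_leftInverse {g k : ℂ → ℂ} (hg : Differentiable ℂ g)
    (hk : Differentiable ℂ k) (hkg : ∀ z, k (g z) = z) (h0 : g 0 = 0) (z : ℂ) :
    g z = z * g 1 := by
  have hne (z : ℂ) (hz : z ≠ 0) : g z ≠ 0 := fun h => hz (by rw [← hkg z, h]; simpa [h0] using hkg 0)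
  have hd : deriv g 0 ≠ 0 := by
    intro h
    have h1 : HasDerivAt (k ∘ g) (deriv k (g 0) * deriv g 0) 0 :=
      (hk _).hasDerivAt.comp 0 (hg 0).hasDerivAt
    rw [show k ∘ g = id from funext hkg, h, mul_zero] at h1
    exact zero_ne_one (h1.unique (hasDerivAt_id 0))
  -- `g z / z` has no zeros, so its reciprocal is entire. The left inverse makes `g` proper, so `1 /
  -- g z` tends to 0 at infinity, and the reciprocal `z / g z` is then constant.
  have hc (z : ℂ) : dslope g 0 z ≠ 0 := by
    by_cases hz : z = 0
    · rw [hz, dslope_same]; exact hd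
    · rw [dslope_of_ne _ hz, slope_def_field, h0, sub_zero, sub_zero]
      exact div_ne_zero (hne z hz) hz
  have hh : Differentiable ℂ fun z => (dslope g 0 z)⁻¹ := (differentiable_dslope hg 0).inv hc
  have hginf : Tendsto g (cocompact ℂ) (cocompact ℂ) := by
    rw [hasBasis_cocompact.tendsto_right_iff]
    intro K hK
    filter_upwards [(hK.image hk.continuous).compl_mem_cocompact] with z hz hgz
    exact hz ⟨g z, hgz, hkg z⟩
  have hlim : Tendsto (fun z => z⁻¹ • ((dslope g 0 z)⁻¹ - (dslope g 0 0)⁻¹)) (cocompact ℂ)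
      (𝓝 0) := by
    have h1 : Tendsto (fun z => (g z)⁻¹ - z⁻¹ * (dslope g 0 0)⁻¹) (cocompact ℂ) (𝓝 0) := by
      simpa using ((tendsto_inv₀_cobounded (α := ℂ)).comp
        ((cobounded_eq_cocompact (α := ℂ)) ▸ hginf)).sub
        (((tendsto_inv₀_cobounded (α := ℂ)).mono_left
          (cobounded_eq_cocompact (α := ℂ)).ge).mul_const (dslope g 0 0)⁻¹)
    refine h1.congr' ?_
    filter_upwards [(isCompact_singleton (x := (0 : ℂ))).compl_mem_cocompact] with z hz
    have hz : z ≠ 0 := hz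
    have := hne z hz
    rw [dslope_of_ne _ hz, slope_def_field, h0, sub_zero, sub_zero, smul_eq_mul]
    field_simp
  have key (z : ℂ) : g z = z * dslope g 0 0 := by
    have h1 := hh.eq_add_smul_of_tendsto hlim z
    rw [smul_zero, add_zero] at h1
    have h2 := sub_smul_dslope g 0 z
    rw [inv_injective h1, h0, sub_zero, sub_zero, smul_eq_mul] at h2
    exact h2.symm
  rw [key z, key 1, one_mul]

theorem eq_zero_of_real_zeros {f : ℂ → ℂ} (hf : Differentiable ℂ f) (h : ∀ x : ℝ, f x = 0)
    (z : ℂ) : f z = 0 := by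
  have hu : Tendsto (fun n : ℕ => ((1 / ((n : ℝ) + 1) : ℝ) : ℂ)) atTop (𝓝[≠] 0) := by
    refine tendsto_nhdsWithin_iff.2 ⟨?_, Eventually.of_forall fun n => ?_⟩
    · exact_mod_cast (Complex.continuous_ofReal.tendsto 0).comp
        tendsto_one_div_add_atTop_nhds_zero_nat
    · simp only [mem_compl_iff, mem_singleton_iff, Complex.ofReal_eq_zero]; positivity
  have := AnalyticOnNhd.eq_of_frequently_eq (z₀ := 0) (f := f) (g := 0)
    (fun z _ => hf.analyticAt z) (fun z _ => analyticAt_const)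
    (hu.frequently (Frequently.of_forall fun n => h _))
  exact congrFun this z

/-- The antidiagonal `{(t, conj t)}` is a set of uniqueness for entire functions on `ℂ × ℂ`. -/
theorem eq_zero_of_conj_zeros {K : ℂ × ℂ → ℂ}
    (h1 : ∀ a b c d : ℂ, Differentiable ℂ fun s => K (a + s * b, c + s * d))
    (h : ∀ t : ℂ, K (t, (starRingEnd ℂ) t) = 0) (z : ℂ × ℂ) : K z = 0 := by
  -- Antidiagonal points are `(x + iy, x - iy)` with `x`, `y` real. First `y`, then `x`, is freed to
  -- be complex, and such points fill `ℂ × ℂ`.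
  have hreal (x : ℝ) (y : ℂ) : K (x + y * Complex.I, x + y * (-Complex.I)) = 0 := by
    refine eq_zero_of_real_zeros (h1 x Complex.I x (-Complex.I)) (fun y => ?_) y
    have := h (x + y * Complex.I)
    simpa using this
  have hall (x y : ℂ) : K (y * Complex.I + x * 1, y * (-Complex.I) + x * 1) = 0 := by
    refine eq_zero_of_real_zeros (h1 (y * Complex.I) 1 (y * -Complex.I) 1) (fun x => ?_) x
    have := hreal x y
    simpa [add_comm] using this
  have := hall ((z.1 + z.2) / 2) ((z.1 - z.2) / (2 * Complex.I))
  have hI := Complex.I_ne_zero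
  convert this using 2
  ext
  · field_simp; ring
  · field_simp; ring

/-! ### Membership in the domain, and entire curves -/

theorem isOpen_domainD (p q : ℕ) : IsOpen (domainD p q) :=
  isOpen_lt continuous_const (by fun_prop)

theorem mem_domainD_of_norm_le {p q : ℕ} {z z' : CSpace p q} (hz : z ∈ domainD p q)
    (hl : ∀ i, ‖z' (Sum.inl i)‖ ≤ ‖z (Sum.inl i)‖) (hr : ∀ j, ‖z (Sum.inr j)‖ ≤ ‖z' (Sum.inr j)‖) :
    z' ∈ domainD p q := by
  have hz : 0 < -(∑ i : Fin q, ‖z (Sum.inl i)‖ ^ 2) + ∑ j : Fin p, ‖z (Sum.inr j)‖ ^ 2 := hz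
  refine hz.trans_le (add_le_add (neg_le_neg ?_) ?_)
  · exact Finset.sum_le_sum fun i _ => pow_le_pow_left₀ (norm_nonneg _) (hl i) 2
  · exact Finset.sum_le_sum fun i _ => pow_le_pow_left₀ (norm_nonneg _) (hr i) 2

theorem mem_domainD_of_sum_norm_lt {p q : ℕ} {z : CSpace p q} {j : Fin p}
    (h : ∑ i : Fin q, ‖z (Sum.inl i)‖ < ‖z (Sum.inr j)‖) : z ∈ domainD p q := by
  have h0 : 0 ≤ ∑ i : Fin q, ‖z (Sum.inl i)‖ := Finset.sum_nonneg fun _ _ => norm_nonneg _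
  have h1 : ∑ i : Fin q, ‖z (Sum.inl i)‖ ^ 2 ≤ (∑ i : Fin q, ‖z (Sum.inl i)‖) ^ 2 :=
    Finset.sum_sq_le_sq_sum_of_nonneg fun _ _ => norm_nonneg _
  have h2 : ‖z (Sum.inr j)‖ ^ 2 ≤ ∑ j : Fin p, ‖z (Sum.inr j)‖ ^ 2 :=
    Finset.single_le_sum (f := fun j => ‖z (Sum.inr j)‖ ^ 2) (fun _ _ => by positivity)
      (Finset.mem_univ j)
  have h3 := pow_lt_pow_left₀ h h0 two_ne_zero
  rw [domainD, mem_ofPred_eq]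
  linarith

/-- A map is entire along curves if its composition with every entire curve is entire. -/
def EntireAlongCurves {E F : Type*} [NormedAddCommGroup E] [NormedSpace ℂ E]
    [NormedAddCommGroup F] [NormedSpace ℂ F] (f : E → F) : Prop :=
  ∀ γ : ℂ → E, Differentiable ℂ γ → Differentiable ℂ (f ∘ γ)

theorem Differentiable.function_update {ι : Type*} [Fintype ι] [DecidableEq ι] {γ : ℂ → ι → ℂ}
    (hγ : Differentiable ℂ γ) {φ : ℂ → ℂ} (hφ : Differentiable ℂ φ) (j : ι) :
    Differentiable ℂ fun s => Function.update (γ s) j (φ s) := by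
  refine differentiable_pi.2 fun i => ?_
  by_cases h : i = j
  · subst h; simpa using hφ
  · simpa [h] using differentiable_pi.1 hγ i

/-! ### Hartogs extension by Cauchy integrals -/

section Hartogs

variable {p q : ℕ} {F : Type*} [NormedAddCommGroup F] [NormedSpace ℂ F]

/-- The Cauchy integral of `f` in the coordinate `z (Sum.inr j)` over a circle of radius `R`. -/
noncomputable def cauchyExtension (f : CSpace p q → F) (j : Fin p) (R : ℝ) (z : CSpace p q) : F :=
  (2 * Real.pi * Complex.I : ℂ)⁻¹ •
    ∮ ζ in C(0, R), (ζ - z (Sum.inr j))⁻¹ • f (Function.update z (Sum.inr j) ζ)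

/-- Circles of radius larger than `hartogsRadius j z` in the `j`-th positive coordinate lie in
the domain and surround `z (Sum.inr j)`. -/
noncomputable def hartogsRadius (j : Fin p) (z : CSpace p q) : ℝ :=
  ∑ i : Fin q, ‖z (Sum.inl i)‖ + ‖z (Sum.inr j)‖

theorem continuous_hartogsRadius (j : Fin p) :
    Continuous (hartogsRadius j : CSpace p q → ℝ) := by
  unfold hartogsRadius; fun_prop

theorem hartogsRadius_nonneg (j : Fin p) (z : CSpace p q) : 0 ≤ hartogsRadius j z :=
  add_nonneg (Finset.sum_nonneg fun _ _ => norm_nonneg _) (norm_nonneg _)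

theorem update_mem_domainD {j : Fin p} {z : CSpace p q} {ζ : ℂ} (h : hartogsRadius j z < ‖ζ‖) :
    Function.update z (Sum.inr j) ζ ∈ domainD p q := by
  refine mem_domainD_of_sum_norm_lt (j := j) ?_
  have := norm_nonneg (z (Sum.inr j))
  simp only [ne_eq, reduceCtorEq, not_false_eq_true, Function.update_of_ne, Function.update_self]
  unfold hartogsRadius at h
  linarith

theorem sub_ne_zero_of_hartogsRadius_lt {j : Fin p} {z : CSpace p q} {ζ : ℂ}
    (h : hartogsRadius j z < ‖ζ‖) : ζ - z (Sum.inr j) ≠ 0 := by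
  intro h0
  rw [sub_eq_zero.1 h0] at h
  have : 0 ≤ ∑ i : Fin q, ‖z (Sum.inl i)‖ := Finset.sum_nonneg fun _ _ => norm_nonneg _
  unfold hartogsRadius at h
  linarith

/-- The integrand is holomorphic on the closed annulus between the two circles. This allows the
radius to vary with the point without affecting the integral. -/
theorem cauchyExtension_radius {f : CSpace p q → F} (hf : DifferentiableOn ℂ f (domainD p q))
    {j : Fin p} {z : CSpace p q} {r R : ℝ} (hr : hartogsRadius j z < r) (hrR : r ≤ R) :
    cauchyExtension f j R z = cauchyExtension f j r z := by
  have hd (ζ : ℂ) (hζ : r ≤ ‖ζ‖) : DifferentiableAt ℂ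
      (fun ζ => (ζ - z (Sum.inr j))⁻¹ • f (Function.update z (Sum.inr j) ζ)) ζ := by
    have h1 := hr.trans_le hζ
    refine DifferentiableAt.smul ((differentiableAt_id.sub_const _).inv
      (sub_ne_zero_of_hartogsRadius_lt h1)) ?_
    exact (hf.differentiableAt ((isOpen_domainD p q).mem_nhds (update_mem_domainD h1))).comp ζ
      ((differentiable_const z).function_update differentiable_id (Sum.inr j) ζ)
  unfold cauchyExtension
  congr 1
  refine Complex.circleIntegral_eq_of_differentiable_on_annulus_off_countable
    ((hartogsRadius_nonneg j z).trans_lt hr) hrR countable_empty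
    (fun ζ hζ => (hd ζ ?_).continuousAt.continuousWithinAt) fun ζ hζ => hd ζ ?_
  · simpa using hζ.2
  · simpa using (not_le.1 (fun h => hζ.1.2 (by simpa using h))).le

variable [CompleteSpace F]

/-- Near a given parameter the radius can be frozen, and then only the integrand depends on the
parameter, holomorphically. -/
theorem entireAlongCurves_cauchyExtension {f : CSpace p q → F}
    (hf : DifferentiableOn ℂ f (domainD p q)) (j : Fin p) :
    EntireAlongCurves fun z => cauchyExtension f j (hartogsRadius j z + 1) z := by
  intro γ hγ s₀
  set R := hartogsRadius j (γ s₀) + 1 with hR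
  have hR0 : 0 ≤ R := add_nonneg (hartogsRadius_nonneg _ _) zero_le_one
  have hnear : ∀ᶠ s in 𝓝 s₀, hartogsRadius j (γ s) < R :=
    ((continuous_hartogsRadius j).comp hγ.continuous).continuousAt.eventually_lt
      continuousAt_const (by simp [hR])
  obtain ⟨r, hr, hball⟩ := nhds_basis_closedBall.mem_iff.1 hnear
  have hmem (s : ℂ) (hs : s ∈ closedBall s₀ r) (ζ : ℂ) (hζ : ζ ∈ sphere (0 : ℂ) R) :
      hartogsRadius j (γ s) < ‖ζ‖ := by
    rw [mem_sphere_zero_iff_norm.1 hζ]; exact hball hs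
  have key : DifferentiableAt ℂ (fun s => cauchyExtension f j R (γ s)) s₀ := by
    refine (differentiableAt_circleIntegral_param hR0 hr ?_ fun ζ hζ s hs => ?_).const_smul _
    · refine ContinuousOn.smul (ContinuousOn.inv₀ ?_ fun x hx =>
        sub_ne_zero_of_hartogsRadius_lt (hmem x.1 hx.1 x.2 hx.2)) ?_
      · exact (continuous_snd.sub
          ((continuous_apply (Sum.inr j)).comp (hγ.continuous.comp continuous_fst))).continuousOn
      · refine hf.continuousOn.comp ?_ fun x hx => update_mem_domainD (hmem x.1 hx.1 x.2 hx.2)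
        exact ((hγ.continuous.comp continuous_fst).update _ continuous_snd).continuousOn
    · have h1 := hmem s hs ζ hζ
      refine DifferentiableAt.smul (((differentiableAt_const _).sub
        (differentiable_pi.1 hγ (Sum.inr j) s)).inv (sub_ne_zero_of_hartogsRadius_lt h1)) ?_
      exact (hf.differentiableAt ((isOpen_domainD p q).mem_nhds (update_mem_domainD h1))).comp s
        (hγ.function_update (differentiable_const ζ) (Sum.inr j) s)
  refine key.congr_of_eventuallyEq ?_
  filter_upwards [hnear] with s hs
  rcases le_total R (hartogsRadius j (γ s) + 1) with h | h
  · exact cauchyExtension_radius hf hs h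
  · exact (cauchyExtension_radius hf (by linarith) h).symm

/-- When the `k`-th positive coordinate alone dominates the negative ones, the whole complex line in
direction `j` lies in the domain, and Cauchy's formula on a disc applies. -/
theorem cauchyExtension_eq_of_sum_norm_lt {f : CSpace p q → F}
    (hf : DifferentiableOn ℂ f (domainD p q)) {j k : Fin p} (hjk : k ≠ j) {z : CSpace p q}
    (h : ∑ i : Fin q, ‖z (Sum.inl i)‖ < ‖z (Sum.inr k)‖) :
    cauchyExtension f j (hartogsRadius j z + 1) z = f z := by
  have hd : Differentiable ℂ fun ζ => f (Function.update z (Sum.inr j) ζ) := by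
    intro ζ
    refine (hf.differentiableAt ((isOpen_domainD p q).mem_nhds
      (mem_domainD_of_sum_norm_lt (j := k) ?_))).comp ζ
      ((differentiable_const z).function_update differentiable_id (Sum.inr j) ζ)
    simpa [hjk] using h
  have hb : z (Sum.inr j) ∈ ball (0 : ℂ) (hartogsRadius j z + 1) := by
    have : 0 ≤ ∑ i : Fin q, ‖z (Sum.inl i)‖ := Finset.sum_nonneg fun _ _ => norm_nonneg _
    rw [mem_ball_zero_iff, hartogsRadius]
    linarith
  have := hd.diffContOnCl.two_pi_i_inv_smul_circleIntegral_sub_inv_smul hb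
  rwa [Function.update_eq_self] at this

/-- Enlarging the `k`-th coordinate keeps a point in the domain and eventually makes that coordinate
dominate. The identity theorem on a half-plane of parameters carries the equality back to the point.
-/
theorem cauchyExtension_eq {f : CSpace p q → F}
    (hf : DifferentiableOn ℂ f (domainD p q)) {j k : Fin p} (hjk : k ≠ j) {z : CSpace p q}
    (hz : z ∈ domainD p q) :
    cauchyExtension f j (hartogsRadius j z + 1) z = f z := by
  set F₁ := fun z => cauchyExtension f j (hartogsRadius j z + 1) z
  -- The direction `c` is parallel to the `k`-th coordinate, or arbitrary if that is 0, so that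
  -- adding `s * c` with `0 ≤ s.re` never shrinks it.
  obtain ⟨c, hc, hzc⟩ : ∃ c : ℂ, c ≠ 0 ∧ (z (Sum.inr k) = 0 ∨ z (Sum.inr k) = c) := by
    by_cases h : z (Sum.inr k) = 0
    · exact ⟨1, one_ne_zero, Or.inl h⟩
    · exact ⟨_, h, Or.inr rfl⟩
  have hnorm (s : ℂ) (hs : 0 ≤ s.re) : ‖z (Sum.inr k)‖ ≤ ‖z (Sum.inr k) + s * c‖ ∧
      s.re * ‖c‖ ≤ ‖z (Sum.inr k) + s * c‖ := by
    rcases hzc with h | h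
    · rw [h, norm_zero, zero_add, norm_mul]
      exact ⟨by positivity, mul_le_mul_of_nonneg_right (Complex.re_le_norm s) (norm_nonneg c)⟩
    · have h1 : 1 + s.re ≤ ‖1 + s‖ := by simpa using Complex.re_le_norm (1 + s)
      have h2 : ‖z (Sum.inr k) + s * c‖ = ‖1 + s‖ * ‖c‖ := by
        rw [h, ← norm_mul]; ring_nf
      have h3 := norm_nonneg c
      rw [h2, h]
      constructor <;> nlinarith
  set γ : ℂ → CSpace p q := fun s => Function.update z (Sum.inr k) (z (Sum.inr k) + s * c) with hγ
  have hγd : Differentiable ℂ γ :=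
    (differentiable_const z).function_update (by fun_prop) (Sum.inr k)
  have hγD (s : ℂ) (hs : 0 ≤ s.re) : γ s ∈ domainD p q := by
    refine mem_domainD_of_norm_le hz (fun i => by simp [hγ]) fun i => ?_
    by_cases hi : i = k
    · subst hi; simpa [hγ] using (hnorm s hs).1
    · simp [hγ, hi]
  have hopen : IsOpen (γ ⁻¹' domainD p q) := (isOpen_domainD p q).preimage hγd.continuous
  have hfγ : AnalyticOnNhd ℂ (f ∘ γ) (γ ⁻¹' domainD p q) :=
    (hf.comp hγd.differentiableOn fun s hs => hs).analyticOnNhd hopen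
  have hFγ : Differentiable ℂ (F₁ ∘ γ) := entireAlongCurves_cauchyExtension hf j γ hγd
  set N : ℝ := (∑ i : Fin q, ‖z (Sum.inl i)‖) / ‖c‖ + 1
  have hN : 0 ≤ N := by positivity
  have hlarge : ∀ᶠ s in 𝓝 (N : ℂ), ∑ i : Fin q, ‖z (Sum.inl i)‖ < ‖z (Sum.inr k) + s * c‖ := by
    refine ContinuousAt.eventually_lt continuousAt_const (by fun_prop) ?_
    refine lt_of_lt_of_le ?_ (hnorm N (by simpa using hN)).2
    have := norm_pos_iff.2 hc
    simp only [N, Complex.ofReal_re, add_mul, div_mul_cancel₀ _ this.ne']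
    linarith
  have heq : EqOn (F₁ ∘ γ) (f ∘ γ) {s | 0 ≤ s.re} := by
    refine AnalyticOnNhd.eqOn_of_preconnected_of_eventuallyEq (z₀ := (N : ℂ))
      (fun s _ => hFγ.analyticAt s) (hfγ.mono hγD) (convex_halfSpace_re_ge 0).isPreconnected
      (by simpa using hN) ?_
    filter_upwards [hlarge] with s hs
    exact cauchyExtension_eq_of_sum_norm_lt hf hjk (by simpa [hγ] using hs)
  have h0 := heq (x := 0) (by simp)
  simpa [hγ, F₁] using h0

/-- **Hartogs' phenomenon**: for `p > 1`, holomorphic maps on `D^{p,q}` extend to the whole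
space. -/
theorem exists_entire_extension (hp : 1 < p) {f : CSpace p q → F}
    (hf : DifferentiableOn ℂ f (domainD p q)) :
    ∃ F₁ : CSpace p q → F, EntireAlongCurves F₁ ∧ EqOn F₁ f (domainD p q) :=
  ⟨_, entireAlongCurves_cauchyExtension hf ⟨0, by omega⟩, fun _ hz =>
    cauchyExtension_eq (k := ⟨1, hp⟩) hf (by simp) hz⟩

end Hartogs

/-! ### The Hermitian form and its orthogonality relation -/

section Form

variable {p q : ℕ}

/-- The Hermitian form defined by `J`, linear in the first variable. -/
noncomputable def hermForm (z w : CSpace p q) : ℂ := star w ⬝ᵥ (signMatrix p q *ᵥ z)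

theorem hermForm_eq (z w : CSpace p q) :
    hermForm z w = -(∑ i : Fin q, star (w (Sum.inl i)) * z (Sum.inl i)) +
      ∑ j : Fin p, star (w (Sum.inr j)) * z (Sum.inr j) := by
  simp only [hermForm, signMatrix, Matrix.fromBlocks_mulVec, dotProduct, Fintype.sum_sum_type]
  simp [Matrix.neg_mulVec]

theorem hermForm_add_left (z z' w : CSpace p q) :
    hermForm (z + z') w = hermForm z w + hermForm z' w := by
  simp [hermForm, Matrix.mulVec_add]

theorem hermForm_smul_left (a : ℂ) (z w : CSpace p q) :
    hermForm (a • z) w = a * hermForm z w := by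
  simp [hermForm, Matrix.mulVec_smul]

theorem hermForm_add_right (z w w' : CSpace p q) :
    hermForm z (w + w') = hermForm z w + hermForm z w' := by
  simp [hermForm]

theorem hermForm_smul_right (a : ℂ) (z w : CSpace p q) :
    hermForm z (a • w) = star a * hermForm z w := by
  simp [hermForm]

theorem star_hermForm (z w : CSpace p q) : star (hermForm z w) = hermForm w z := by
  simp only [hermForm_eq, star_add, star_neg, star_sum, star_mul', star_star, mul_comm]

theorem hermForm_self (z : CSpace p q) :
    hermForm z z = ((-(∑ i : Fin q, ‖z (Sum.inl i)‖ ^ 2) + ∑ j : Fin p, ‖z (Sum.inr j)‖ ^ 2 : ℝ) :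
      ℂ) := by
  rw [hermForm_eq]
  push_cast
  simp only [← Complex.conj_mul', starRingEnd_apply]

theorem mem_domainD_iff {z : CSpace p q} : z ∈ domainD p q ↔ 0 < (hermForm z z).re := by
  rw [hermForm_self, Complex.ofReal_re]; rfl

theorem hermForm_self_eq_re (z : CSpace p q) : hermForm z z = ((hermForm z z).re : ℂ) := by
  rw [hermForm_self, Complex.ofReal_re]

theorem continuous_hermForm_self : Continuous fun z : CSpace p q => (hermForm z z).re := by
  simp only [hermForm_self, Complex.ofReal_re]; fun_prop

theorem single_inr_mem_domainD (j : Fin p) : Pi.single (Sum.inr j) 1 ∈ domainD p q :=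
  mem_domainD_of_sum_norm_lt (j := j) (by simp)

/-- An isotropic vector is a limit of points of the domain along a real ray. -/
theorem exists_ray_mem_domainD (hp : 0 < p) {z : CSpace p q} (hz : hermForm z z = 0) :
    ∃ w : CSpace p q, ∀ t : ℝ, 0 < t → z + (t : ℂ) • w ∈ domainD p q := by
  by_cases h0 : z = 0
  · refine ⟨Pi.single (Sum.inr ⟨0, hp⟩) 1, fun t ht => ?_⟩
    refine mem_domainD_of_sum_norm_lt (j := ⟨0, hp⟩) ?_
    simp [h0, ht.ne']
  · have hz' : -(∑ i : Fin q, ‖z (Sum.inl i)‖ ^ 2) + ∑ j : Fin p, ‖z (Sum.inr j)‖ ^ 2 = 0 := by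
      rw [hermForm_self] at hz; exact_mod_cast hz
    have hl : 0 ≤ ∑ i : Fin q, ‖z (Sum.inl i)‖ ^ 2 := Finset.sum_nonneg fun _ _ => by positivity
    have hpos : 0 < ∑ j : Fin p, ‖z (Sum.inr j)‖ ^ 2 := by
      refine lt_of_le_of_ne (Finset.sum_nonneg fun _ _ => by positivity) fun h => h0 ?_
      have h1 : ∑ i : Fin q, ‖z (Sum.inl i)‖ ^ 2 = 0 := by linarith
      rw [Finset.sum_eq_zero_iff_of_nonneg fun _ _ => by positivity] at h1
      have h2 := (Finset.sum_eq_zero_iff_of_nonneg fun _ _ => by positivity).1 h.symm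
      ext (i | j)
      · simpa using h1 i (Finset.mem_univ i)
      · simpa using h2 j (Finset.mem_univ j)
    -- The ray direction is the positive part of `z`; the form along the ray is `(2t + t²)` times
    -- its squared norm.
    refine ⟨Sum.elim 0 fun j => z (Sum.inr j), fun t ht => ?_⟩
    have h3 (j : Fin p) : ‖z (Sum.inr j) + t * z (Sum.inr j)‖ ^ 2 =
        (1 + t) ^ 2 * ‖z (Sum.inr j)‖ ^ 2 := by
      rw [← one_add_mul, norm_mul, mul_pow, ← Complex.ofReal_one, ← Complex.ofReal_add,
        Complex.norm_real, Real.norm_eq_abs, sq_abs]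
    simp only [domainD, mem_ofPred_eq, Pi.add_apply, Pi.smul_apply, Sum.elim_inl, Pi.zero_apply,
      Sum.elim_inr, smul_eq_mul, mul_zero, add_zero, h3, ← Finset.mul_sum]
    nlinarith [mul_pos ht hpos, mul_pos (mul_pos ht ht) hpos]

/-- The orthogonal complement of a non-isotropic vector contains vectors of opposite sign. -/
theorem exists_orthogonal_opposite_sign (hp : 0 < p) (hq : 0 < q) {z : CSpace p q}
    (hz : (hermForm z z).re ≠ 0) :
    ∃ n : CSpace p q, hermForm z n = 0 ∧ (hermForm z z).re * (hermForm n n).re < 0 := by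
  have hs : (hermForm z z).re = -(∑ i : Fin q, ‖z (Sum.inl i)‖ ^ 2) +
      ∑ j : Fin p, ‖z (Sum.inr j)‖ ^ 2 := by
    rw [hermForm_self, Complex.ofReal_re]
  set a := ∑ i : Fin q, ‖z (Sum.inl i)‖ ^ 2 with ha
  set b := ∑ j : Fin p, ‖z (Sum.inr j)‖ ^ 2 with hb
  have ha0 : 0 ≤ a := Finset.sum_nonneg fun _ _ => by positivity
  have hb0 : 0 ≤ b := Finset.sum_nonneg fun _ _ => by positivity
  rcases ha0.eq_or_lt with ha1 | ha1
  · have h2 := (Finset.sum_eq_zero_iff_of_nonneg fun _ _ => by positivity).1 (ha ▸ ha1.symm)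
    refine ⟨Pi.single (Sum.inl ⟨0, hq⟩) 1, ?_, ?_⟩
    · have h3 := h2 ⟨0, hq⟩ (Finset.mem_univ _)
      rw [hermForm_eq]
      simp only [sq_eq_zero_iff, norm_eq_zero] at h3
      simp [Pi.single_apply, h3]
    · have h3 : (hermForm (Pi.single (Sum.inl ⟨0, hq⟩) 1 : CSpace p q)
          (Pi.single (Sum.inl ⟨0, hq⟩) 1)).re = -1 := by
        rw [hermForm_eq]; simp [Pi.single_apply]
      rw [h3]
      have : 0 < b := lt_of_le_of_ne hb0 fun h => hz (by rw [hs, ← ha1, ← h]; simp)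
      linarith
  rcases hb0.eq_or_lt with hb1 | hb1
  · have h2 := (Finset.sum_eq_zero_iff_of_nonneg fun _ _ => by positivity).1 (hb ▸ hb1.symm)
    refine ⟨Pi.single (Sum.inr ⟨0, hp⟩) 1, ?_, ?_⟩
    · have h3 := h2 ⟨0, hp⟩ (Finset.mem_univ _)
      rw [hermForm_eq]
      simp only [sq_eq_zero_iff, norm_eq_zero] at h3
      simp [Pi.single_apply, h3]
    · have h3 : (hermForm (Pi.single (Sum.inr ⟨0, hp⟩) 1 : CSpace p q)
          (Pi.single (Sum.inr ⟨0, hp⟩) 1)).re = 1 := by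
        rw [hermForm_eq]; simp [Pi.single_apply]
      rw [h3]
      linarith
  -- Weighting the two parts by each other's squared norms gives `h z n = -ba + ab = 0` and `h n n =
  -- ab(a - b) = -ab · h z z`.
  · refine ⟨Sum.elim (fun i => b * z (Sum.inl i)) (fun j => a * z (Sum.inr j)), ?_, ?_⟩
    · have h1 : ∑ i : Fin q, star ((b : ℂ) * z (Sum.inl i)) * z (Sum.inl i) = ((b * a : ℝ) : ℂ) := by
        rw [ha, Finset.mul_sum]; push_cast
        refine Finset.sum_congr rfl fun i _ => ?_
        rw [← Complex.conj_mul']; simp [mul_assoc]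
      have h2 : ∑ i : Fin p, star ((a : ℂ) * z (Sum.inr i)) * z (Sum.inr i) = ((a * b : ℝ) : ℂ) := by
        rw [hb, Finset.mul_sum]; push_cast
        refine Finset.sum_congr rfl fun i _ => ?_
        rw [← Complex.conj_mul']; simp [mul_assoc]
      rw [hermForm_eq]
      simp only [Sum.elim_inl, Sum.elim_inr, h1, h2]
      push_cast; ring
    · rw [hs, hermForm_self, Complex.ofReal_re]
      simp only [Sum.elim_inl, Sum.elim_inr, norm_mul, mul_pow, ← Finset.mul_sum, ← ha, ← hb,
        Complex.norm_real, Real.norm_eq_abs, sq_abs]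
      have h1 : -a + b ≠ 0 := hs ▸ hz
      have h2 : 0 < (-a + b) ^ 2 := by positivity
      have h3 : 0 < a * b := mul_pos ha1 hb1
      nlinarith [mul_pos h3 h2]

/-- Vectors whose orthogonal complements are nested are proportional. -/
theorem exists_eq_smul_of_orthogonal {y y' : CSpace p q} {i : Fin q ⊕ Fin p}
    (hi : y i ≠ 0) (h : ∀ x : CSpace p q, hermForm x y = 0 → hermForm x y' = 0) :
    y' = (y' i / y i) • y := by
  let ε : Fin q ⊕ Fin p → ℂ := Sum.elim (fun _ => -1) (fun _ => 1)
  have hε (k) : ε k * ε k = 1 := by rcases k with k | k <;> simp [ε]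
  have hform (w : CSpace p q) (a b : ℂ) (j k : Fin q ⊕ Fin p) :
      hermForm (a • Pi.single j (ε j) + b • Pi.single k (ε k)) w = a * star (w j) + b * star (w k) := by
    have h1 (k : Fin q ⊕ Fin p) : hermForm (Pi.single k (ε k)) w = star (w k) := by
      rw [hermForm_eq]
      rcases k with k | k <;> simp [ε, Pi.single_apply]
    rw [hermForm_add_left, hermForm_smul_left, hermForm_smul_left, h1, h1]
  ext j
  -- This vector is orthogonal to `y`, the signs `ε` cancelling those of `J`. Its orthogonality to
  -- `y'` says that the `(i, j)` minor of `y`, `y'` vanishes.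
  have h1 := h (star (y i) • Pi.single j (ε j) + (-star (y j)) • Pi.single i (ε i))
    (by rw [hform]; ring)
  rw [hform, neg_mul, ← sub_eq_add_neg, sub_eq_zero, ← star_mul', ← star_mul'] at h1
  have h2 := star_injective h1
  rw [Pi.smul_apply, smul_eq_mul]
  field_simp
  linear_combination h2

end Form

/-! ### From null vectors to orthogonality -/

section Orthogonality

variable {p q : ℕ}

/-- The form is antilinear in its second slot, so conjugating the parameter there restores
holomorphy. -/
theorem EntireAlongCurves.differentiable_hermForm {F : CSpace p q → CSpace p q}
    (hF : EntireAlongCurves F) {γ δ : ℂ → CSpace p q} (hγ : Differentiable ℂ γ)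
    (hδ : Differentiable ℂ δ) :
    Differentiable ℂ fun s => hermForm (F (γ s)) (F (δ (star s))) := by
  have h1 (i) : Differentiable ℂ fun s => F (γ s) i := differentiable_pi.1 (hF γ hγ) i
  have h2 (i) : Differentiable ℂ fun s => star (F (δ (star s)) i) := fun s => by
    have := (differentiable_pi.1 (hF δ hδ) i (star s)).conj_conj
    rwa [starRingEnd_apply, star_star] at this
  simp only [hermForm_eq]
  exact (Differentiable.fun_sum fun i _ => (h2 _).mul (h1 _)).neg.add
    (Differentiable.fun_sum fun i _ => (h2 _).mul (h1 _))

/-- Polarisation of the condition that `F` preserves isotropic vectors. -/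
theorem hermForm_map_eq_zero_of_add_eq_zero {F : CSpace p q → CSpace p q}
    (hF : EntireAlongCurves F) (hnull : ∀ z, hermForm z z = 0 → hermForm (F z) (F z) = 0)
    {e f : CSpace p q}
    (hef : hermForm e f = 0) (hsum : hermForm e e + hermForm f f = 0) (r : ℝ) :
    hermForm (F e) (F ((r : ℂ) • f)) = 0 := by
  set c : ℂ := (r : ℂ) - 1 with hc
  have hcs : star c = c := by simp [hc]
  have hfe : hermForm f e = 0 := by rw [← star_hermForm, hef, star_zero]
  -- At `(t, conj t)` both slots hold the image of the same vector, which is isotropic by `hef` and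
  -- `hsum`. At `(1, 0)` the slots hold `F e` and `F (r • f)`: the scalar factor, with `c = r - 1`,
  -- is what produces `r`.
  let K : ℂ × ℂ → ℂ := fun x => hermForm (F ((1 + c * x.2) • (x.1 • e + x.2 • f)))
    (F ((1 + c * star x.1) • (star x.2 • e + star x.1 • f)))
  have hK : K (1, 0) = 0 := by
    refine eq_zero_of_conj_zeros (K := K) (fun a b a' b' => ?_) (fun t => ?_) (1, 0)
    · convert hF.differentiable_hermForm
        (γ := fun s => (1 + c * (a' + s * b')) • ((a + s * b) • e + (a' + s * b') • f))
        (δ := fun s => (1 + c * (star a + s * star b)) •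
          ((star a' + s * star b') • e + (star a + s * star b) • f))
        (by fun_prop) (by fun_prop) using 3 with s
      simp
    · change hermForm (F ((1 + c * star t) • (t • e + star t • f)))
        (F ((1 + c * star t) • (star (star t) • e + star t • f))) = 0
      rw [star_star]
      apply hnull
      simp only [hermForm_smul_left, hermForm_smul_right, hermForm_add_left, hermForm_add_right,
        hef, hfe, star_star, mul_zero, add_zero, zero_add]
      linear_combination (1 + c * star t) * star (1 + c * star t) * (t * star t) * hsum
  simpa [K, hc] using hK

/-- Rescaling `w` by `ρ` makes the two values of the form cancel; the free real factor `r = ρ⁻¹`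
then undoes the scaling inside `F`. -/
theorem hermForm_map_eq_zero_of_opposite_sign {F : CSpace p q → CSpace p q}
    (hF : EntireAlongCurves F) (hnull : ∀ z, hermForm z z = 0 → hermForm (F z) (F z) = 0)
    {z w : CSpace p q} (hzw : hermForm z w = 0)
    (hs : (hermForm z z).re * (hermForm w w).re < 0) : hermForm (F z) (F w) = 0 := by
  have hw : (hermForm w w).re ≠ 0 := fun h => by simp [h] at hs
  have hquot : 0 < -(hermForm z z).re / (hermForm w w).re := by
    rw [neg_div, neg_pos]; exact div_neg_iff.2 (mul_neg_iff.1 hs)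
  set ρ : ℝ := √(-(hermForm z z).re / (hermForm w w).re) with hρ
  have hρ0 : (ρ : ℂ) ≠ 0 := by exact_mod_cast (Real.sqrt_pos.2 hquot).ne'
  have hρ2 : ρ * ρ = -(hermForm z z).re / (hermForm w w).re := Real.mul_self_sqrt hquot.le
  have h := hermForm_map_eq_zero_of_add_eq_zero hF hnull (e := z) (f := (ρ : ℂ) • w)
    (by rw [hermForm_smul_right, hzw, mul_zero]) ?_ ρ⁻¹
  · rwa [smul_smul, ← Complex.ofReal_mul, inv_mul_cancel₀ (by exact_mod_cast hρ0),
      Complex.ofReal_one, one_smul] at h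
  · rw [hermForm_smul_left, hermForm_smul_right, hermForm_self_eq_re z, hermForm_self_eq_re w]
    rw [eq_div_iff hw] at hρ2
    simp only [Complex.star_def, Complex.conj_ofReal]
    norm_cast
    linarith

/-- Analytic continuation inside the orthogonal complement of `z`: the line from a vector `n` of
opposite sign to `w` stays there, and near `n` the sign remains opposite. -/
theorem hermForm_map_eq_zero_of_ne_zero {F : CSpace p q → CSpace p q}
    (hF : EntireAlongCurves F) (hnull : ∀ z, hermForm z z = 0 → hermForm (F z) (F z) = 0)
    (hp : 0 < p) (hq : 0 < q) {z w : CSpace p q}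
    (hzw : hermForm z w = 0) (hz : (hermForm z z).re ≠ 0) : hermForm (F z) (F w) = 0 := by
  obtain ⟨n, hzn, hn⟩ := exists_orthogonal_opposite_sign hp hq hz
  have hd := hF.differentiable_hermForm (γ := fun _ => z) (δ := fun s => n + s • (w - n))
    (by fun_prop) (by fun_prop)
  have hwn : hermForm z (w - n) = 0 := by
    have := hermForm_add_right z (w - n) n
    rwa [sub_add_cancel, hzw, hzn, add_zero, eq_comm] at this
  have hnear : ∀ᶠ s : ℂ in 𝓝 0, (hermForm z z).re *
      (hermForm (n + star s • (w - n)) (n + star s • (w - n))).re < 0 := by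
    have hc : Continuous fun s : ℂ => (hermForm z z).re *
        (hermForm (n + star s • (w - n)) (n + star s • (w - n))).re :=
      continuous_const.mul (continuous_hermForm_self.comp
        (continuous_const.add (continuous_star.smul continuous_const)))
    refine hc.continuousAt.eventually_lt continuousAt_const ?_
    simpa using hn
  have h := AnalyticOnNhd.eq_of_eventuallyEq (z₀ := 0) (g := 0) (fun s _ => hd.analyticAt s)
    (fun s _ => analyticAt_const) (by
      filter_upwards [hnear] with s hs
      exact hermForm_map_eq_zero_of_opposite_sign hF hnull
        (by rw [hermForm_add_right, hermForm_smul_right, hzn, hwn, mul_zero, add_zero]) hs)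
  simpa using congrFun h 1

/-- A map which is entire along curves and preserves isotropic vectors preserves orthogonality. -/
theorem hermForm_map_eq_zero {F : CSpace p q → CSpace p q}
    (hF : EntireAlongCurves F) (hnull : ∀ z, hermForm z z = 0 → hermForm (F z) (F z) = 0)
    (hp : 0 < p) (hq : 0 < q) {z w : CSpace p q}
    (hzw : hermForm z w = 0) : hermForm (F z) (F w) = 0 := by
  by_cases hz : (hermForm z z).re = 0
  · by_cases hw : (hermForm w w).re = 0
    · have := hermForm_map_eq_zero_of_add_eq_zero hF hnull hzw
        (by rw [hermForm_self_eq_re z, hermForm_self_eq_re w, hz, hw]; simp) 1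
      simpa using this
    · rw [← star_hermForm, hermForm_map_eq_zero_of_ne_zero hF hnull hp hq _ hw, star_zero]
      rw [← star_hermForm, hzw, star_zero]
  · exact hermForm_map_eq_zero_of_ne_zero hF hnull hp hq hzw hz

end Orthogonality

/-! ### Linearity of the extension -/

section Linear

variable {p q : ℕ}

theorem eq_zero_of_forall_hermForm_eq_zero {y : CSpace p q} (h : ∀ x, hermForm x y = 0) :
    y = 0 := by
  ext (i | j)
  · simpa [hermForm_eq, Pi.single_apply] using h (Pi.single (Sum.inl i) 1)
  · simpa [hermForm_eq, Pi.single_apply] using h (Pi.single (Sum.inr j) 1)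

/-- Pulling back by `G` shows that whatever is orthogonal to `F v` is orthogonal to `F (s • v)`, so
the two are proportional. -/
theorem map_smul_eq_div_smul {F G : CSpace p q → CSpace p q}
    (hGF : ∀ z, G (F z) = z) (hFG : ∀ z, F (G z) = z)
    (hFo : ∀ z w, hermForm z w = 0 → hermForm (F z) (F w) = 0)
    (hGo : ∀ z w, hermForm z w = 0 → hermForm (G z) (G w) = 0)
    {v : CSpace p q} {i : Fin q ⊕ Fin p} (hi : F v i ≠ 0) (s : ℂ) :
    F (s • v) = (F (s • v) i / F v i) • F v := by
  refine exists_eq_smul_of_orthogonal hi fun x hx => ?_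
  have h1 := hGo _ _ hx
  rw [hGF] at h1
  rw [← hFG x]
  exact hFo _ _ (by rw [hermForm_smul_right, h1, mul_zero])

theorem map_zero_of_orthogonal {F G : CSpace p q → CSpace p q} (hFG : ∀ z, F (G z) = z)
    (hFo : ∀ z w, hermForm z w = 0 → hermForm (F z) (F w) = 0) : F 0 = 0 :=
  eq_zero_of_forall_hermForm_eq_zero fun x => by
    rw [← hFG x]; exact hFo _ _ (by simp [hermForm])

theorem EntireAlongCurves.differentiable_line {F : CSpace p q → CSpace p q}
    (hF : EntireAlongCurves F) (v w : CSpace p q) : Differentiable ℂ fun s : ℂ => F (v + s • w) :=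
  hF (fun s => v + s • w) (by fun_prop)

theorem map_smul_of_orthogonal {F G : CSpace p q → CSpace p q}
    (hF : EntireAlongCurves F) (hG : EntireAlongCurves G)
    (hGF : ∀ z, G (F z) = z) (hFG : ∀ z, F (G z) = z)
    (hFo : ∀ z w, hermForm z w = 0 → hermForm (F z) (F w) = 0)
    (hGo : ∀ z w, hermForm z w = 0 → hermForm (G z) (G w) = 0) (s : ℂ) (v : CSpace p q) :
    F (s • v) = s • F v := by
  have hF0 := map_zero_of_orthogonal hFG hFo
  have hG0 := map_zero_of_orthogonal hGF hGo
  by_cases hv : v = 0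
  · rw [hv, smul_zero, hF0, smul_zero]
  obtain ⟨j, hj⟩ := Function.ne_iff.1 hv
  obtain ⟨i, hi⟩ := Function.ne_iff.1 (show F v ≠ 0 from fun h => hv (by rw [← hGF v, h, hG0]))
  rw [Pi.zero_apply] at hi hj
  set g : ℂ → ℂ := fun s => F (s • v) i / F v i
  set k : ℂ → ℂ := fun s => G (s • F v) j / v j
  have hg : Differentiable ℂ g := by
    have := hF.differentiable_line 0 v
    simp only [zero_add] at this
    exact (differentiable_pi.1 this i).div_const _
  have hk : Differentiable ℂ k := by
    have := hG.differentiable_line 0 (F v)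
    simp only [zero_add] at this
    exact (differentiable_pi.1 this j).div_const _
  have hprop (s : ℂ) : F (s • v) = g s • F v := map_smul_eq_div_smul hGF hFG hFo hGo hi s
  -- The scalar function describing `G` on the image line is an entire left inverse of `g`, which
  -- forces `g` to be linear.
  have hkg (s : ℂ) : k (g s) = s := by
    simp only [k]
    rw [← hprop, hGF, Pi.smul_apply, smul_eq_mul, mul_div_cancel_right₀ _ hj]
  rw [hprop, eq_mul_of_entire_leftInverse hg hk hkg (by simp [g, hF0]) s]
  simp [g, hi]

/-- By homogeneity `F (v + s • w) / s = F (w + s⁻¹ • v)`, which tends to `F w` at infinity. So `F`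
is affine with slope `F w` on the line, and `s = 1` gives the claim. -/
theorem map_add_of_map_smul {F : CSpace p q → CSpace p q} (hF : EntireAlongCurves F)
    (hs : ∀ (s : ℂ) v, F (s • v) = s • F v) (v w : CSpace p q) : F (v + w) = F v + F w := by
  have hlim : Tendsto (fun s : ℂ => s⁻¹ • (F (v + s • w) - F (v + (0 : ℂ) • w))) (cocompact ℂ)
      (𝓝 (F w)) := by
    have hinv : Tendsto (fun s : ℂ => s⁻¹) (cocompact ℂ) (𝓝 0) :=
      (tendsto_inv₀_cobounded (α := ℂ)).mono_left (Metric.cobounded_eq_cocompact (α := ℂ)).ge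
    have h1 : Tendsto (fun s : ℂ => F (w + s⁻¹ • v) - s⁻¹ • F v) (cocompact ℂ)
        (𝓝 (F (w + (0 : ℂ) • v) - (0 : ℂ) • F v)) :=
      (((hF.differentiable_line w v).continuous.tendsto 0).comp hinv).sub
        (hinv.smul tendsto_const_nhds)
    rw [zero_smul, zero_smul, add_zero, sub_zero] at h1
    refine h1.congr' ?_
    filter_upwards [(isCompact_singleton (x := (0 : ℂ))).compl_mem_cocompact] with s hs0
    have hs0 : s ≠ 0 := hs0
    rw [smul_sub, ← hs s⁻¹ (v + s • w), smul_add, smul_smul, inv_mul_cancel₀ hs0, one_smul,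
      zero_smul, add_zero, add_comm w]
  simpa using (hF.differentiable_line v w).eq_add_smul_of_tendsto hlim 1

/-- An entire self-map of the space which is inverse to another one and agrees on `D^{p,q}` with
a self-map of `D^{p,q}` preserves isotropic vectors. -/
theorem hermForm_self_map_eq_zero (hp : 0 < p) {F G : CSpace p q → CSpace p q}
    (hF : EntireAlongCurves F) (hGF : ∀ z, G (F z) = z)
    (hFD : MapsTo F (domainD p q) (domainD p q)) (hGD : MapsTo G (domainD p q) (domainD p q))
    {z : CSpace p q} (hz : hermForm z z = 0) : hermForm (F z) (F z) = 0 := by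
  rw [hermForm_self_eq_re, Complex.ofReal_eq_zero]
  -- A positive value would put `z = G (F z)` in the domain; a negative one is excluded since `z` is
  -- a limit of points of the domain.
  refine le_antisymm (not_lt.1 fun h => ?_) ?_
  · have h1 := hGD (mem_domainD_iff.2 h)
    rw [hGF, mem_domainD_iff, hz] at h1
    exact lt_irrefl _ h1
  · obtain ⟨w, hw⟩ := exists_ray_mem_domainD hp hz
    have hc : Continuous fun t : ℝ => (hermForm (F (z + (t : ℂ) • w)) (F (z + (t : ℂ) • w))).re :=
      continuous_hermForm_self.comp
        ((hF.differentiable_line z w).continuous.comp Complex.continuous_ofReal)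
    have h1 := (hc.tendsto 0).mono_left (nhdsWithin_le_nhds (s := Ioi 0))
    simp only [Complex.ofReal_zero, zero_smul, add_zero] at h1
    exact ge_of_tendsto h1 (eventually_mem_nhdsWithin.mono fun t ht =>
      (mem_domainD_iff.1 (hFD (hw t ht))).le)

/-- Identity theorem on the complex line joining a point of the domain to `z`. -/
theorem EntireAlongCurves.comp_eq_id {F G : CSpace p q → CSpace p q} (hp : 0 < p)
    (hF : EntireAlongCurves F) (hG : EntireAlongCurves G)
    (hGF : ∀ z ∈ domainD p q, G (F z) = z) (z : CSpace p q) : G (F z) = z := by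
  set e : CSpace p q := Pi.single (Sum.inr ⟨0, hp⟩) 1
  have he : e ∈ domainD p q := single_inr_mem_domainD _
  set γ : ℂ → CSpace p q := fun s => e + s • (z - e) with hγ
  have hγd : Differentiable ℂ γ := by fun_prop
  have hd : Differentiable ℂ (G ∘ (F ∘ γ)) := hG _ (hF γ hγd)
  have h := AnalyticOnNhd.eq_of_eventuallyEq (z₀ := 0) (fun s _ => hd.analyticAt s)
    (fun s _ => hγd.analyticAt s) (by
      filter_upwards [hγd.continuous.continuousAt.preimage_mem_nhds
        ((isOpen_domainD p q).mem_nhds (by simpa [hγ] using he))] with s hs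
      exact hGF _ hs)
  simpa [hγ] using congrFun h 1

/-- Every biholomorphic self-map of `D^{p,q}` is the restriction of an invertible linear map
which preserves orthogonality. -/
theorem exists_linear_of_holomorphic (hp : 1 < p) (hq : 0 < q) {f g : CSpace p q → CSpace p q}
    (hf : DifferentiableOn ℂ f (domainD p q)) (hg : DifferentiableOn ℂ g (domainD p q))
    (hfD : MapsTo f (domainD p q) (domainD p q)) (hgD : MapsTo g (domainD p q) (domainD p q))
    (hgf : ∀ z ∈ domainD p q, g (f z) = z) (hfg : ∀ z ∈ domainD p q, f (g z) = z) :
    ∃ L : CSpace p q ≃ₗ[ℂ] CSpace p q, (∀ z ∈ domainD p q, L z = f z) ∧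
      ∀ z w, hermForm z w = 0 → hermForm (L z) (L w) = 0 := by
  have hp0 : 0 < p := by omega
  obtain ⟨F, hF, hFf⟩ := exists_entire_extension hp hf
  obtain ⟨G, hG, hGg⟩ := exists_entire_extension hp hg
  have hFD : MapsTo F (domainD p q) (domainD p q) := hfD.congr hFf.symm
  have hGD : MapsTo G (domainD p q) (domainD p q) := hgD.congr hGg.symm
  have hGF := hF.comp_eq_id hp0 hG fun z hz => by rw [hFf hz, hGg (hfD hz), hgf z hz]
  have hFG := hG.comp_eq_id hp0 hF fun z hz => by rw [hGg hz, hFf (hgD hz), hfg z hz]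
  have hFo : ∀ z w, hermForm z w = 0 → hermForm (F z) (F w) = 0 := fun z w =>
    hermForm_map_eq_zero hF (fun z => hermForm_self_map_eq_zero hp0 hF hGF hFD hGD) hp0 hq
  have hGo : ∀ z w, hermForm z w = 0 → hermForm (G z) (G w) = 0 := fun z w =>
    hermForm_map_eq_zero hG (fun z => hermForm_self_map_eq_zero hp0 hG hFG hGD hFD) hp0 hq
  have hs := map_smul_of_orthogonal hF hG hGF hFG hFo hGo
  exact ⟨{ toFun := F, invFun := G, left_inv := hGF, right_inv := hFG, map_smul' := hs,
           map_add' := map_add_of_map_smul hF hs }, hFf, hFo⟩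

end Linear

/-! ### The group isomorphism and its topology -/

section Group

variable {p q : ℕ}

theorem hermForm_mulVec (A : Matrix (Fin q ⊕ Fin p) (Fin q ⊕ Fin p) ℂ) (z w : CSpace p q) :
    hermForm (A *ᵥ z) (A *ᵥ w) = star w ⬝ᵥ ((Aᴴ * signMatrix p q * A) *ᵥ z) := by
  simp only [hermForm, Matrix.star_mulVec, ← Matrix.mulVec_mulVec, ← Matrix.dotProduct_mulVec]

/-- A linear map which preserves orthogonality and the domain multiplies the form by a positive
scalar. -/
theorem mul_signMatrix_mul_eq_smul (hp : 0 < p) {A : Matrix (Fin q ⊕ Fin p) (Fin q ⊕ Fin p) ℂ}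
    (ho : ∀ z w, hermForm z w = 0 → hermForm (A *ᵥ z) (A *ᵥ w) = 0)
    (hD : ∀ z ∈ domainD p q, A *ᵥ z ∈ domainD p q) :
    ∃ ν : ℝ, 0 < ν ∧ Aᴴ * signMatrix p q * A = (ν : ℂ) • signMatrix p q := by
  let e : Fin q ⊕ Fin p → CSpace p q := fun i => Pi.single i 1
  let j₀ : Fin q ⊕ Fin p := Sum.inr ⟨0, hp⟩
  let b : CSpace p q → CSpace p q → ℂ := fun z w => hermForm (A *ᵥ z) (A *ᵥ w)
  have hent (i j) : (Aᴴ * signMatrix p q * A) i j = b (e j) (e i) := by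
    simp [b, e, hermForm_mulVec, Pi.star_single]
  have hJ (i j) : hermForm (e j) (e i) = signMatrix p q i j := by
    simp [e, hermForm, Pi.star_single]
  have hoff (i j) (hij : i ≠ j) : signMatrix p q i j = 0 := by
    rcases i with i | i <;> rcases j with j | j <;>
      simp_all [signMatrix, Matrix.one_apply]
  have hl (i : Fin q) : signMatrix p q (Sum.inl i) (Sum.inl i) = -1 := by simp [signMatrix]
  have hr (i : Fin p) : signMatrix p q (Sum.inr i) (Sum.inr i) = 1 := by simp [signMatrix]
  have hb0 (i j) (hij : i ≠ j) : b (e i) (e j) = 0 :=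
    ho _ _ (by rw [hJ]; exact hoff _ _ hij.symm)
  have hν := mem_domainD_iff.1 (hD (e j₀) (single_inr_mem_domainD _))
  refine ⟨_, hν, ?_⟩
  rw [← hermForm_self_eq_re]
  -- The vectors `e i + e j` and `e i + a • e j` are orthogonal under this condition on `a`. Taking
  -- `a = 1` for opposite signs and `a = -1` for equal signs compares each diagonal entry with that
  -- at `j₀`.
  have hadd (i j) (a : ℂ) (hij : i ≠ j)
      (h : signMatrix p q i i + star a * signMatrix p q j j = 0) :
      b (e i) (e i) + star a * b (e j) (e j) = 0 := by
    have h1 := ho (e i + e j) (e i + a • e j) (by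
      simp only [hermForm_add_left, hermForm_add_right, hermForm_smul_right, hJ,
        hoff _ _ hij, hoff _ _ hij.symm, add_zero, zero_add, h])
    simp only [Matrix.mulVec_add, Matrix.mulVec_smul, hermForm_add_left, hermForm_add_right,
      hermForm_smul_right] at h1
    have h2 := hb0 i j hij
    have h3 := hb0 j i hij.symm
    simp only [b] at h2 h3 ⊢
    rw [h2, h3] at h1
    linear_combination h1
  ext i j
  rw [hent, Matrix.smul_apply, smul_eq_mul]
  by_cases hij : i = j
  · subst hij
    rcases i with i | i
    · rw [hl]
      have := hadd (Sum.inl i) j₀ 1 (by simp [j₀]) (by rw [hl, hr]; simp)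
      simp only [star_one, one_mul] at this
      linear_combination this
    · rw [hr, mul_one]
      by_cases hi : Sum.inr i = j₀
      · rw [hi]
      · have := hadd (Sum.inr i) j₀ (-1) hi (by rw [hr, hr]; simp)
        simp only [star_neg, star_one] at this
        linear_combination this
  · rw [hoff i j hij, mul_zero, hb0 j i (Ne.symm hij)]

theorem mulVec_mem_domainD (A : generalIndefiniteUnitaryGroup p q) {z : CSpace p q}
    (hz : z ∈ domainD p q) : (A : GL (Fin q ⊕ Fin p) ℂ).val *ᵥ z ∈ domainD p q := by
  obtain ⟨ν, hν, hA⟩ := A.2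
  rw [mem_domainD_iff] at hz ⊢
  rw [hermForm_mulVec, hA, Matrix.smul_mulVec, dotProduct_smul, smul_eq_mul, Complex.re_ofReal_mul]
  exact mul_pos hν hz

/-- The action of an element of `GU(p,q)` on `D^{p,q}`. -/
noncomputable def linearHomeomorph (A : generalIndefiniteUnitaryGroup p q) :
    domainD p q ≃ₜ domainD p q where
  toFun z := ⟨(A : GL (Fin q ⊕ Fin p) ℂ).val *ᵥ z.1, mulVec_mem_domainD A z.2⟩
  invFun z := ⟨(A⁻¹ : generalIndefiniteUnitaryGroup p q).1.val *ᵥ z.1, mulVec_mem_domainD A⁻¹ z.2⟩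
  left_inv z := by
    ext1
    simp [-Matrix.coe_units_inv, Matrix.mulVec_mulVec, ← Units.val_mul]
  right_inv z := by
    ext1
    simp [-Matrix.coe_units_inv, Matrix.mulVec_mulVec, ← Units.val_mul]
  continuous_toFun := by fun_prop
  continuous_invFun := by fun_prop

theorem differentiable_mulVec (A : Matrix (Fin q ⊕ Fin p) (Fin q ⊕ Fin p) ℂ) :
    Differentiable ℂ fun z : CSpace p q => A *ᵥ z :=
  (LinearMap.toContinuousLinearMap A.mulVecLin).differentiable

/-- The homomorphism `GU(p,q) → Aut(D^{p,q})`. -/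
noncomputable def linearAutHom (p q : ℕ) :
    generalIndefiniteUnitaryGroup p q →* holomorphicAut (domainD p q) where
  toFun A := ⟨linearHomeomorph A, ⟨_, (differentiable_mulVec A.1.val).differentiableOn, fun _ => rfl⟩,
    ⟨_, (differentiable_mulVec (A⁻¹).1.val).differentiableOn, fun _ => rfl⟩⟩
  map_one' := by
    ext z : 3
    exact Matrix.one_mulVec (z : CSpace p q)
  map_mul' A B := by
    ext z : 3
    exact (Matrix.mulVec_mulVec (z : CSpace p q) A.1.val B.1.val).symm

/-- The difference of the values of a linear map at these two points is its `k`-th column, so the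
map is determined, continuously, by its values on the domain. -/
theorem exists_add_single_mem_domainD (hp : 0 < p) (k : Fin q ⊕ Fin p) :
    ∃ v : CSpace p q, v ∈ domainD p q ∧ v + Pi.single k 1 ∈ domainD p q := by
  -- The entry 2 strictly exceeds the norm 1 of an added negative basis vector.
  refine ⟨Pi.single (Sum.inr ⟨0, hp⟩) 2, mem_domainD_of_sum_norm_lt (j := ⟨0, hp⟩) (by simp),
    mem_domainD_of_sum_norm_lt (j := ⟨0, hp⟩) ?_⟩
  rcases k with k | k
  · have (i : Fin q) : ‖(Pi.single (Sum.inl k) 1 : CSpace p q) (Sum.inl i)‖ = if i = k then 1 else 0 := by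
      by_cases h : i = k <;> simp [h]
    simp [this]
  · by_cases h : k = ⟨0, hp⟩
    · subst h
      have h3 : (2 : ℂ) + 1 = 3 := by norm_num
      simp [h3]
    · simp [Ne.symm h]

theorem linearAutHom_injective (hp : 0 < p) : Function.Injective (linearAutHom p q) := by
  intro A B h
  have h1 (z : CSpace p q) (hz : z ∈ domainD p q) : A.1.val *ᵥ z = B.1.val *ᵥ z :=
    congrArg (fun f : holomorphicAut (domainD p q) => ((f.1 ⟨z, hz⟩ : domainD p q) : CSpace p q)) h
  apply Subtype.ext
  apply Units.ext
  refine Matrix.ext_of_mulVec_single fun k => ?_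
  obtain ⟨v, hv, hvk⟩ := exists_add_single_mem_domainD hp k
  have h2 := h1 _ hvk
  rwa [Matrix.mulVec_add, Matrix.mulVec_add, h1 v hv, add_left_cancel_iff] at h2

theorem linearAutHom_surjective (hp : 1 < p) (hq : 0 < q) :
    Function.Surjective (linearAutHom p q) := by
  rintro ⟨φ, ⟨f, hf, hfφ⟩, ⟨g, hg, hgφ⟩⟩
  have hfD : MapsTo f (domainD p q) (domainD p q) := fun z hz => by
    rw [hfφ ⟨z, hz⟩]; exact (φ _).2
  have hgD : MapsTo g (domainD p q) (domainD p q) := fun z hz => by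
    rw [hgφ ⟨z, hz⟩]; exact (φ.symm _).2
  obtain ⟨L, hL, hLo⟩ := exists_linear_of_holomorphic hp hq hf hg hfD hgD
    (fun z hz => by rw [hfφ ⟨z, hz⟩, hgφ, φ.symm_apply_apply])
    (fun z hz => by rw [hgφ ⟨z, hz⟩, hfφ, φ.apply_symm_apply])
  let A : GL (Fin q ⊕ Fin p) ℂ := ⟨LinearMap.toMatrix' L, LinearMap.toMatrix' L.symm,
    by rw [← LinearMap.toMatrix'_comp]; simp, by rw [← LinearMap.toMatrix'_comp]; simp⟩
  have hA (z : CSpace p q) : A.val *ᵥ z = L z := LinearMap.toMatrix'_mulVec _ _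
  have hAmem : A ∈ generalIndefiniteUnitaryGroup p q :=
    mul_signMatrix_mul_eq_smul (by omega) (fun z w h => by rw [hA, hA]; exact hLo z w h)
      fun z hz => by rw [hA, hL z hz]; exact hfD hz
  refine ⟨⟨A, hAmem⟩, ?_⟩
  ext z : 3
  exact (hA z).trans ((hL z z.2).trans (hfφ z))

theorem continuous_linearAutHom : Continuous (linearAutHom p q) := by
  refine continuous_induced_rng.2 (ContinuousMap.continuous_of_continuous_uncurry _ ?_)
  refine Continuous.subtype_mk ?_ _
  exact Continuous.matrix_mulVec (Units.continuous_val.comp (continuous_subtype_val.comp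
    continuous_fst)) (continuous_subtype_val.comp continuous_snd)

theorem continuous_of_linearAutHom_rightInverse (hp : 0 < p)
    {Ψ : holomorphicAut (domainD p q) → generalIndefiniteUnitaryGroup p q}
    (hΨ : ∀ f, linearAutHom p q (Ψ f) = f) : Continuous Ψ := by
  have happly (f : holomorphicAut (domainD p q)) (z : domainD p q) :
      (Ψ f).1.val *ᵥ z.1 = (f.1 z : domainD p q) :=
    congrArg (fun f : holomorphicAut (domainD p q) => ((f.1 z : domainD p q) : CSpace p q)) (hΨ f)
  have heval (z : domainD p q) : Continuous fun f : holomorphicAut (domainD p q) =>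
      ((f.1 z : domainD p q) : CSpace p q) := by
    have h : Continuous fun f : holomorphicAut (domainD p q) =>
        ((f.1 : domainD p q ≃ₜ domainD p q) : C(domainD p q, domainD p q)) :=
      continuous_induced_dom
    exact continuous_subtype_val.comp
      ((continuous_eval_const (F := C(domainD p q, domainD p q)) z).comp h)
  have hval : Continuous fun f => (Ψ f).1.val := by
    refine continuous_matrix fun i k => ?_
    obtain ⟨v, hv, hvk⟩ := exists_add_single_mem_domainD hp k
    have h1 (f : holomorphicAut (domainD p q)) : (Ψ f).1.val i k =
        ((f.1 ⟨_, hvk⟩ : domainD p q) : CSpace p q) i - ((f.1 ⟨v, hv⟩ : domainD p q) : CSpace p q) i := by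
      rw [← happly, ← happly, Matrix.mulVec_add]
      simp
    simp only [h1]
    exact ((continuous_apply i).comp (heval _)).sub ((continuous_apply i).comp (heval _))
  -- The topology on units also requires continuity of the inverse matrix, which holds because the
  -- determinant is a unit.
  refine continuous_induced_rng.2 (Units.continuous_iff.2 ⟨hval, ?_⟩)
  refine continuous_iff_continuousAt.2 fun f => ?_
  simp only [Function.comp_apply, Matrix.coe_units_inv]
  refine ContinuousAt.comp (f := fun f => (Ψ f).1.val) (continuousAt_matrix_inv _ ?_)
    hval.continuousAt
  simpa using NormedRing.inverse_continuousAt (Matrix.GeneralLinearGroup.det (Ψ f).1)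

end Group

theorem mainTheorem4 (p q : ℕ) (hp : 1 < p) (hq : 0 < q) :
    ∃ Φ : generalIndefiniteUnitaryGroup p q ≃ₜ* holomorphicAut (domainD p q),
      ∀ (A : generalIndefiniteUnitaryGroup p q) (z : domainD p q),
        (((Φ A : domainD p q ≃ₜ domainD p q) z : domainD p q) : CSpace p q) =
          ((A : GL (Fin q ⊕ Fin p) ℂ) : Matrix (Fin q ⊕ Fin p) (Fin q ⊕ Fin p) ℂ) *ᵥ
            (z : CSpace p q) := by
  have hp0 : 0 < p := by omega
  let Φ := MulEquiv.ofBijective (linearAutHom p q)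
    ⟨linearAutHom_injective hp0, linearAutHom_surjective hp hq⟩
  exact ⟨{ Φ with
    continuous_toFun := continuous_linearAutHom
    continuous_invFun := continuous_of_linearAutHom_rightInverse hp0 Φ.apply_symm_apply },
    fun A z => rfl⟩
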